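/- Let $\le_{\mathrm W}$ and $\equiv_{\mathrm W}$ denote Weihrauch reducibility and equivalence of partial multi-valued functions between represented spaces (with names in $\{0,1\}^{\mathbb N}$): $f\le_{\mathrm W} g$ iff there are computable $K,H:\subseteq\{0,1\}^{\mathbb N}\to\{0,1\}^{\mathbb N}$ such that $p\mapsto K\langle p,G(H(p))\rangle$ is a realizer of $f$ for every realizer $G$ of $g$. For such $f,g$ let $f\star g$ denote the Weihrauch degree $$f\star g=\max\nolimits_{\le_{\mathrm W}}\{f_0\circ g_0 \mid f_0\equiv_{\mathrm W} f,\ g_0\equiv_{\mathrm W} g\},$$ where $f_0,g_0$ range over all pairs for which the composition $f_0\circ g_0$ is defined type-wise. Let $\lim:\subseteq\mathbb N^{\mathbb N}\to\mathbb N^{\mathbb N}$ be given by $\lim(p)(n)=\lim_{i\to\infty}p(\langle n,i\rangle)$, defined on those $p$ for which all these limits exist, and let $\mathsf{Sort}:\{0,1\}^{\mathbb N}\to\{0,1\}^{\mathbb N}$ be given by $\mathsf{Sort}(p)=0^n1^\omega$ if $p$ contains exactly $n$ times the bit $0$, and $\mathsf{Sort}(p)=0^\omega$ if $p$ contains infinitely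 many $0$s. Then the maxima defining $\lim\star\lim$, $\lim\star\mathsf{Sort}$, $(\lim\star\lim)\star\mathsf{Sort}$ and $\lim\star(\lim\star\mathsf{Sort})$ exist, and $$\lim\star\lim\star\mathsf{Sort}\equiv_{\mathrm W}\lim\star\lim$$ for both ways of bracketing the left-hand side. -/

import Mathlib

open Filter Topology

namespace Weihrauch

/-- Cantor space: infinite binary sequences, where `false` is the bit `0` and `true` the bit `1`. -/
abbrev Cantor : Type := ℕ → Bool

/-- The finite prefix `p(0) … p(n-1)` of a binary sequence. -/
def pre (p : Cantor) (n : ℕ) : List Bool := (List.range n).map p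

/-- Type-2 computability of a partial function `F` on Cantor space. A Type-2 machine with one-way
output is given by the computable prefix-monotone map `M` that sends a finite input word to the
output word written by the time the machine has read that word; its output on an infinite input
`p` is the limit of the words `M (pre p k)`. The machine has to produce `F p` for every `p` in the
domain of `F`; its behaviour outside of the domain is unconstrained. -/
def Type2Computable (F : Cantor →. Cantor) : Prop :=
  ∃ M : List Bool → List Bool, Computable M ∧
    (∀ u v : List Bool, u <+: v → M u <+: M v) ∧
    ∀ p q : Cantor, q ∈ F p → ∀ n : ℕ, ∃ k : ℕ, pre q n <+: M (pre p k)

/-- The pairing `⟨p, q⟩ = p(0) q(0) p(1) q(1) …` on Cantor space. -/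
def pair (p q : Cantor) : Cantor := fun n => if n % 2 = 0 then p (n / 2) else q (n / 2)

/-- A represented space: a set with a partial surjection from Cantor space onto it, given by its
graph (`name p x` says that the partial surjection is defined at `p` with value `x`). -/
structure RepSpace where
  carrier : Type
  name : Cantor → carrier → Prop
  name_unique : ∀ p x y, name p x → name p y → x = y
  name_surj : ∀ x, ∃ p, name p x

/-- Partial multi-valued functions between represented spaces. The domain of `f` is
`{x | (f x).Nonempty}`. -/
abbrev MultiFun (X Y : RepSpace) : Type := X.carrier → Set Y.carrier

/-- Composition of partial multi-valued functions: `x` lies in the domain of `f ∘ g` iff it lies in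
the domain of `g` and all of `g x` lies in the domain of `f`. -/
def MultiFun.comp {X Y Z : RepSpace} (f : MultiFun Y Z) (g : MultiFun X Y) : MultiFun X Z :=
  fun x => {z | (∀ y ∈ g x, (f y).Nonempty) ∧ ∃ y ∈ g x, z ∈ f y}

/-- `F` is a realizer of `f`. -/
def Realizes {X Y : RepSpace} (F : Cantor →. Cantor) (f : MultiFun X Y) : Prop :=
  ∀ p x, X.name p x → (f x).Nonempty → ∃ q ∈ F p, ∃ y ∈ f x, Y.name q y

/-- A problem: a partial multi-valued function together with its source and target. -/
structure Problem where
  source : RepSpace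
  target : RepSpace
  fn : MultiFun source target

/-- Weihrauch reducibility `f ≤_W g`: there are computable `K`, `H` such that
`p ↦ K ⟨p, G (H p)⟩` realizes `f` whenever `G` realizes `g`. -/
def Reducible (f g : Problem) : Prop :=
  ∃ K H : Cantor →. Cantor, Type2Computable K ∧ Type2Computable H ∧
    ∀ G : Cantor →. Cantor, Realizes G g.fn →
      Realizes (fun p => (H p).bind fun r => (G r).bind fun s => K (pair p s)) f.fn

/-- Weihrauch equivalence. -/
def Equivalent (f g : Problem) : Prop := Reducible f g ∧ Reducible g f

/-- `h` represents the degree `f ⋆ g`, that is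
`f ⋆ g = max {f₀ ∘ g₀ | f₀ ≡_W f, g₀ ≡_W g}` with respect to Weihrauch reducibility, where `f₀` and
`g₀` run over all pairs with matching types. -/
def IsStar (f g h : Problem) : Prop :=
  (∃ (X Y Z : RepSpace) (f₀ : MultiFun Y Z) (g₀ : MultiFun X Y),
    Equivalent ⟨Y, Z, f₀⟩ f ∧ Equivalent ⟨X, Y, g₀⟩ g ∧ Equivalent ⟨X, Z, f₀.comp g₀⟩ h) ∧
  ∀ (X Y Z : RepSpace) (f₀ : MultiFun Y Z) (g₀ : MultiFun X Y),
    Equivalent ⟨Y, Z, f₀⟩ f → Equivalent ⟨X, Y, g₀⟩ g → Reducible ⟨X, Z, f₀.comp g₀⟩ h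

/-- Cantor space represented by the identity. -/
def cantorSpace : RepSpace where
  carrier := Cantor
  name p x := p = x
  name_unique _ _ _ hx hy := hx.symm.trans hy
  name_surj x := ⟨x, rfl⟩

/-- The position of the `n`-th `1` in the sequence `0^{a(0)} 1 0^{a(1)} 1 0^{a(2)} 1 …`. -/
def onePos (a : ℕ → ℕ) (n : ℕ) : ℕ := (∑ i ∈ Finset.range (n + 1), a i) + n

theorem onePos_strictMono (a : ℕ → ℕ) : StrictMono (onePos a) := by
  refine strictMono_nat_of_lt_succ fun n => ?_
  unfold onePos
  rw [Finset.sum_range_succ _ (n + 1)]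
  omega

theorem onePos_injective : Function.Injective onePos := by
  intro a b h
  funext n
  have key : ∀ m, ∑ i ∈ Finset.range (m + 1), a i = ∑ i ∈ Finset.range (m + 1), b i := by
    intro m
    have := congrFun h m
    unfold onePos at this
    omega
  cases n with
  | zero => simpa using key 0
  | succ n =>
    have h1 := key n
    have h2 := key (n + 1)
    rw [Finset.sum_range_succ _ (n + 1), Finset.sum_range_succ _ (n + 1)] at h2
    omega

/-- Baire space, where the name of `a` is `0^{a(0)} 1 0^{a(1)} 1 0^{a(2)} 1 …`. -/
def baireSpace : RepSpace where
  carrier := ℕ → ℕ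
  name p a := ∀ k, p k = true ↔ ∃ n, onePos a n = k
  name_unique p a b ha hb := by
    apply onePos_injective
    apply ((onePos_strictMono a).range_inj (onePos_strictMono b)).1
    ext k
    exact (ha k).symm.trans (hb k)
  name_surj a := by
    classical
    exact ⟨fun k => decide (∃ n, onePos a n = k), fun k => by simp⟩

/-- `lim : ⊆ ℕ^ℕ → ℕ^ℕ`, `lim(p)(n) = lim_{i → ∞} p(⟨n, i⟩)`, defined where all these limits exist
(in the discrete space `ℕ`). -/
def limProblem : Problem where
  source := baireSpace
  target := baireSpace
  fn := fun (p : ℕ → ℕ) => {q : ℕ → ℕ | ∀ n, Tendsto (fun i => p (Nat.pair n i)) atTop (𝓝 (q n))}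

open Classical in
/-- `0^n 1^ω` if `p` contains exactly `n` times the bit `0`, and `0^ω` if `p` contains infinitely
many `0`s. -/
noncomputable def sortSeq (p : Cantor) : Cantor :=
  if {i | p i = false}.Finite then fun k => decide ({i | p i = false}.ncard ≤ k)
  else fun _ => false

/-- The problem `Sort` of sorting an infinite binary sequence. -/
noncomputable def sortProblem : Problem where
  source := cantorSpace
  target := cantorSpace
  fn := fun p => {sortSeq p}

end Weihrauch

namespace Weihrauch

-- The upper bounds rest on describing the degrees below lim and lim ∘ lim by words. Once lim is
-- moved to Cantor space (`limCantor_equivalent_limProblem`), a problem is below lim iff a name of a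
-- solution is the limit, prefix by prefix, of words computed from growing prefixes of the input
-- (`LimComputable`). It is below lim ∘ lim iff such a name is an iterated limit over i, then j, of
-- words computed from i and the first j letters (`LimLimComputable`). The latter only asks each
-- fixed prefix to be right for all late i and then all late j, so inner limits may fail to exist;
-- `regularize` forces them to exist, as an input of lim ∘ lim requires.
--
-- Sort reveals a single discrete datum: the number of zeros, possibly infinite. An iterated limit
-- finds it exactly: at stage i, guess "infinite" once more than i zeros have appeared
-- (`eventually_zeroGuess`). This guess shares the indices i and j with the two limits that follow
-- Sort, so Sort costs no third limit. That gives `LimLimComputable.comp_reducible_sort` and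
-- `LimComputable.comp_reducible_limSort`, one for each bracketing.
--
-- The degree lim ⋆ Sort is represented by `limSort`: Sort has countably many possible results, so
-- the input of the later lim can be prepared for all of them in parallel, and the true result
-- selects one. For the lower bounds, lim ∘ lim can ignore what Sort did to a second component, and
-- `limSort` becomes lim when all selectable double sequences coincide.

attribute [fun_prop] Computable

/-! ### Closure properties of computable functions, for `fun_prop` -/

section Toolbox

variable {α β γ : Type*} [Primcodable α] [Primcodable β] [Primcodable γ]

@[fun_prop] theorem computable_id' : Computable (fun a : α => a) := Computable.id

@[fun_prop] theorem computable_const' (b : β) : Computable (fun _ : α => b) := Computable.const b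

@[fun_prop] theorem computable_comp' {f : β → γ} {g : α → β} (hf : Computable f)
    (hg : Computable g) : Computable (fun a => f (g a)) := hf.comp hg

@[fun_prop] theorem computable_fst' {f : α → β × γ} (hf : Computable f) :
    Computable (fun a => (f a).1) := Computable.fst.comp hf

@[fun_prop] theorem computable_snd' {f : α → β × γ} (hf : Computable f) :
    Computable (fun a => (f a).2) := Computable.snd.comp hf

@[fun_prop] theorem computable_mk' {f : α → β} {g : α → γ} (hf : Computable f)
    (hg : Computable g) : Computable (fun a => (f a, g a)) := hf.pair hg

@[fun_prop] theorem computable_add {f g : α → ℕ} (hf : Computable f) (hg : Computable g) :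
    Computable (fun a => f a + g a) := Primrec.nat_add.to_comp.comp hf hg

@[fun_prop] theorem computable_sub {f g : α → ℕ} (hf : Computable f) (hg : Computable g) :
    Computable (fun a => f a - g a) := Primrec.nat_sub.to_comp.comp hf hg

@[fun_prop] theorem computable_mul {f g : α → ℕ} (hf : Computable f) (hg : Computable g) :
    Computable (fun a => f a * g a) := Primrec.nat_mul.to_comp.comp hf hg

@[fun_prop] theorem computable_div {f g : α → ℕ} (hf : Computable f) (hg : Computable g) :
    Computable (fun a => f a / g a) := Primrec.nat_div.to_comp.comp hf hg

@[fun_prop] theorem computable_mod {f g : α → ℕ} (hf : Computable f) (hg : Computable g) :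
    Computable (fun a => f a % g a) := Primrec.nat_mod.to_comp.comp hf hg

@[fun_prop] theorem computable_min {f g : α → ℕ} (hf : Computable f) (hg : Computable g) :
    Computable (fun a => min (f a) (g a)) := Primrec.nat_min.to_comp.comp hf hg

@[fun_prop] theorem computable_sqrt {f : α → ℕ} (hf : Computable f) :
    Computable (fun a => Nat.sqrt (f a)) :=
  (Nat.Primrec'.prim_iff₁.1 Nat.Primrec'.sqrt).to_comp.comp hf

@[fun_prop] theorem computable_natPair {f g : α → ℕ} (hf : Computable f) (hg : Computable g) :
    Computable (fun a => Nat.pair (f a) (g a)) := Primrec₂.natPair.to_comp.comp hf hg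

@[fun_prop] theorem computable_unpair {f : α → ℕ} (hf : Computable f) :
    Computable (fun a => Nat.unpair (f a)) := Computable.unpair.comp hf

@[fun_prop] theorem computable_ite {c : α → Prop} [DecidablePred c] {f g : α → β}
    (hc : Computable fun a => decide (c a)) (hf : Computable f) (hg : Computable g) :
    Computable (fun a => if c a then f a else g a) :=
  (Computable.cond hc hf hg).of_eq fun a => by by_cases h : c a <;> simp [h]

@[fun_prop] theorem computable_decide_lt {f g : α → ℕ} (hf : Computable f) (hg : Computable g) :
    Computable (fun a => decide (f a < g a)) := Primrec.nat_lt.decide.to_comp.comp hf hg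

@[fun_prop] theorem computable_decide_le {f g : α → ℕ} (hf : Computable f) (hg : Computable g) :
    Computable (fun a => decide (f a ≤ g a)) := Primrec.nat_le.decide.to_comp.comp hf hg

@[fun_prop] theorem computable_decide_eq [DecidableEq β] {f g : α → β} (hf : Computable f)
    (hg : Computable g) : Computable (fun a => decide (f a = g a)) :=
  Primrec.eq.decide.to_comp.comp hf hg

@[fun_prop] theorem computable_and {f g : α → Bool} (hf : Computable f) (hg : Computable g) :
    Computable (fun a => f a && g a) := Primrec.and.to_comp.comp hf hg

@[fun_prop] theorem computable_or {f g : α → Bool} (hf : Computable f) (hg : Computable g) :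
    Computable (fun a => f a || g a) := Primrec.or.to_comp.comp hf hg

@[fun_prop] theorem computable_length {f : α → List β} (hf : Computable f) :
    Computable (fun a => (f a).length) := Computable.list_length.comp hf

@[fun_prop] theorem computable_take {f : α → ℕ} {g : α → List β} (hf : Computable f)
    (hg : Computable g) : Computable (fun a => (g a).take (f a)) :=
  Primrec.list_take.to_comp.comp hf hg

@[fun_prop] theorem computable_getD {f : α → ℕ} {g : α → List β} (d : β) (hf : Computable f)
    (hg : Computable g) : Computable (fun a => (g a).getD (f a) d) :=
  (Primrec.list_getD d).to_comp.comp hg hf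

theorem computable_nat_rec {z : α → β} {s : α → ℕ → β → β} {n : α → ℕ} (hn : Computable n)
    (hz : Computable z) (hs : Computable fun x : α × ℕ × β => s x.1 x.2.1 x.2.2) :
    Computable (fun a => Nat.rec (motive := fun _ => β) (z a) (s a) (n a)) :=
  Computable.nat_rec (h := fun a y => s a y.1 y.2) hn hz hs

@[fun_prop] theorem computable_range_map {f : α → ℕ} {g : α → ℕ → β} (hf : Computable f)
    (hg : Computable fun x : α × ℕ => g x.1 x.2) :
    Computable (fun a => (List.range (f a)).map (g a)) := by
  have : Computable (fun a => Nat.rec (motive := fun _ => List β) []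
      (fun n l => l ++ [g a n]) (f a)) :=
    computable_nat_rec (s := fun a n l => l ++ [g a n]) hf (Computable.const _)
      (Computable.list_concat.comp (Computable.snd.comp Computable.snd)
        (hg.comp (Computable.fst.pair (Computable.fst.comp Computable.snd))))
  refine this.of_eq fun a => ?_
  induction f a with
  | zero => rfl
  | succ n ih => rw [List.range_succ, List.map_append, ← ih]; rfl

@[fun_prop] theorem computable_pre {f : α → ℕ} {g : α → ℕ → Bool}
    (hg : Computable fun x : α × ℕ => g x.1 x.2) (hf : Computable f) :
    Computable (fun a => pre (g a) (f a)) := computable_range_map hf hg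

end Toolbox

/-! ### Words, prefixes and monotone machines -/

/-- The `n`-th letter of a binary word, with default `false` beyond its end. -/
def bit (w : List Bool) (n : ℕ) : Bool := w.getD n false

@[fun_prop] theorem computable_bit {α : Type*} [Primcodable α] {f : α → List Bool} {g : α → ℕ}
    (hf : Computable f) (hg : Computable g) : Computable (fun a => bit (f a) (g a)) := by
  unfold bit; fun_prop

@[simp] theorem length_pre (p : Cantor) (n : ℕ) : (pre p n).length = n := by simp [pre]

theorem bit_pre {p : Cantor} {n k : ℕ} (h : k < n) : bit (pre p n) k = p k := by
  simp [bit, pre, List.getD_eq_getElem?_getD, h]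

theorem prefix_iff {u v : List Bool} :
    u <+: v ↔ u.length ≤ v.length ∧ ∀ k < u.length, bit u k = bit v k := by
  constructor
  · rintro ⟨t, rfl⟩
    refine ⟨by simp, fun k hk => ?_⟩
    simp [bit, List.getD_eq_getElem?_getD, List.getElem?_append_left hk]
  · rintro ⟨h, H⟩
    rw [List.prefix_iff_getElem?]
    intro i hi
    have := H i hi
    simp only [bit, List.getD_eq_getElem?_getD] at this
    rw [List.getElem?_eq_getElem (hi.trans_le h)] at this ⊢
    rw [List.getElem?_eq_getElem hi] at this
    simpa using this.symm

theorem pre_prefix_iff {p : Cantor} {n : ℕ} {v : List Bool} :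
    pre p n <+: v ↔ n ≤ v.length ∧ ∀ k < n, bit v k = p k := by
  rw [prefix_iff, length_pre]
  refine and_congr_right fun _ => forall₂_congr fun k hk => ?_
  rw [bit_pre hk, eq_comm]

theorem pre_prefix_pre {p : Cantor} {m n : ℕ} (h : m ≤ n) : pre p m <+: pre p n :=
  pre_prefix_iff.2 ⟨by simpa, fun _ hk => bit_pre (hk.trans_le h)⟩

theorem pre_prefix_pre_iff {p q : Cantor} {m n : ℕ} :
    pre p m <+: pre q n ↔ m ≤ n ∧ ∀ k < m, p k = q k := by
  rw [pre_prefix_iff, length_pre]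
  refine and_congr_right fun h => forall₂_congr fun k hk => ?_
  rw [bit_pre (hk.trans_le h), eq_comm]

theorem take_pre {p : Cantor} {m n : ℕ} (h : m ≤ n) : (pre p n).take m = pre p m := by
  have := List.prefix_iff_eq_take.1 (pre_prefix_pre (p := p) h)
  simpa using this.symm

/-- The word `M (pre p k)` converges to `q` as `k` grows, for a prefix-monotone `M`. -/
def Computes (M : List Bool → List Bool) (p q : Cantor) : Prop :=
  ∀ n, ∃ k, pre q n <+: M (pre p k)

/-- `M` is a computable prefix-monotone word function. -/
def IsMachine (M : List Bool → List Bool) : Prop :=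
  Computable M ∧ ∀ u v, u <+: v → M u <+: M v

theorem type2Computable_iff {F : Cantor →. Cantor} :
    Type2Computable F ↔ ∃ M, IsMachine M ∧ ∀ p q, q ∈ F p → Computes M p q := by
  simp [Type2Computable, IsMachine, Computes, and_assoc]

/-- By monotonicity, the output at stage j and a long prefix of q are both prefixes of one later
output, hence comparable. So a machine never writes a wrong letter. -/
theorem Computes.eq_pre {M : List Bool → List Bool} {p q : Cantor} (hM : IsMachine M)
    (h : Computes M p q) (j : ℕ) : M (pre p j) = pre q (M (pre p j)).length := by
  obtain ⟨k, hk⟩ := h (M (pre p j)).length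
  have h1 := hk.trans (hM.2 _ _ (pre_prefix_pre (p := p) (le_max_right j k)))
  have h2 := hM.2 _ _ (pre_prefix_pre (p := p) (le_max_left j k))
  exact (List.prefix_of_prefix_length_le h2 h1 (by simp)).eq_of_length (by simp)

theorem Computes.exists_length {M : List Bool → List Bool} {p q : Cantor} (hM : IsMachine M)
    (h : Computes M p q) : ∃ L : ℕ → ℕ, Tendsto L atTop atTop ∧ ∀ j, M (pre p j) = pre q (L j) := by
  refine ⟨fun j => (M (pre p j)).length, tendsto_atTop.2 fun n => ?_, h.eq_pre hM⟩
  obtain ⟨k, hk⟩ := h n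
  filter_upwards [eventually_ge_atTop k] with j hj
  simpa using (hk.trans (hM.2 _ _ (pre_prefix_pre hj))).length_le

/-! ### Type-2 computable maps: composition and pairing -/

/-- The total function `F` on Cantor space as a partial function. -/
def total (F : Cantor → Cantor) : Cantor →. Cantor := fun p => Part.some (F p)

theorem mem_total {F : Cantor → Cantor} {p q : Cantor} : q ∈ total F p ↔ q = F p := Part.mem_some_iff

/-- The bound 2m + 2 on the letters read is what `odds` needs: its letter m is letter 2m + 1 of the
input. -/
theorem type2Computable_total {F : Cantor → Cantor} (g : List Bool → ℕ → Bool)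
    (hg : Computable fun x : List Bool × ℕ => g x.1 x.2)
    (h : ∀ p m, F p m = g (pre p (2 * m + 2)) m) : Type2Computable (total F) := by
  refine type2Computable_iff.2 ⟨fun w => pre (fun m => g (w.take (2 * m + 2)) m) (w.length / 2),
    ⟨by fun_prop, fun u v huv => ?_⟩, fun p q hq n => ⟨2 * n, ?_⟩⟩
  · refine pre_prefix_pre_iff.2 ⟨Nat.div_le_div_right huv.length_le, fun k hk => ?_⟩
    congr 1
    obtain ⟨t, rfl⟩ := huv
    rw [List.take_append_of_le_length (by omega)]
  · rw [mem_total] at hq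
    subst hq
    simp only [length_pre]
    refine pre_prefix_pre_iff.2 ⟨by omega, fun k hk => ?_⟩
    rw [h, take_pre (by omega)]

theorem Type2Computable.comp {F G : Cantor →. Cantor} (hF : Type2Computable F)
    (hG : Type2Computable G) : Type2Computable (fun p => (G p).bind F) := by
  obtain ⟨M, hM, HM⟩ := type2Computable_iff.1 hF
  obtain ⟨N, hN, HN⟩ := type2Computable_iff.1 hG
  refine type2Computable_iff.2 ⟨fun w => M (N w),
    ⟨hM.1.comp hN.1, fun u v h => hM.2 _ _ (hN.2 _ _ h)⟩, fun p q hq n => ?_⟩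
  obtain ⟨r, hr, hq⟩ := Part.mem_bind_iff.1 hq
  obtain ⟨k, hk⟩ := HM _ _ hq n
  obtain ⟨j, hj⟩ := HN _ _ hr k
  exact ⟨j, hk.trans (hM.2 _ _ hj)⟩

/-- The word analogue of `pair`. -/
def inter (u v : List Bool) : List Bool :=
  pre (pair (bit u) (bit v)) (2 * min u.length v.length)

@[fun_prop] theorem computable_inter {α : Type*} [Primcodable α] {f g : α → List Bool}
    (hf : Computable f) (hg : Computable g) : Computable (fun a => inter (f a) (g a)) := by
  unfold inter pair
  fun_prop

theorem inter_mono {u u' v v' : List Bool} (hu : u <+: u') (hv : v <+: v') :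
    inter u v <+: inter u' v' := by
  have h1 := hu.length_le
  have h2 := hv.length_le
  refine pre_prefix_pre_iff.2 ⟨by omega, fun k hk => ?_⟩
  unfold pair
  rw [(prefix_iff.1 hu).2 _ (by omega), (prefix_iff.1 hv).2 _ (by omega)]

theorem inter_pre (p q : Cantor) (m n : ℕ) :
    inter (pre p m) (pre q n) = pre (pair p q) (2 * min m n) := by
  refine List.IsPrefix.eq_of_length (pre_prefix_pre_iff.2 ⟨by simp, fun k hk => ?_⟩) (by simp [inter])
  simp only [length_pre] at hk
  unfold pair
  rw [bit_pre (by omega), bit_pre (by omega)]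

theorem Type2Computable.pair {F G : Cantor →. Cantor} (hF : Type2Computable F)
    (hG : Type2Computable G) :
    Type2Computable (fun p => (F p).bind fun a => (G p).bind fun b => Part.some (pair a b)) := by
  obtain ⟨M, hM, HM⟩ := type2Computable_iff.1 hF
  obtain ⟨N, hN, HN⟩ := type2Computable_iff.1 hG
  refine type2Computable_iff.2 ⟨fun w => inter (M w) (N w),
    ⟨computable_inter hM.1 hN.1, fun u v h => inter_mono (hM.2 _ _ h) (hN.2 _ _ h)⟩,
    fun p q hq n => ?_⟩
  simp only [Part.mem_bind_iff, Part.mem_some_iff] at hq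
  obtain ⟨a, ha, b, hb, rfl⟩ := hq
  obtain ⟨k, hk⟩ := HM _ _ ha n
  obtain ⟨j, hj⟩ := HN _ _ hb n
  refine ⟨max k j, (?_ : _ <+: inter (pre a n) (pre b n)).trans (inter_mono
    (hk.trans (hM.2 _ _ (pre_prefix_pre (le_max_left _ _))))
    (hj.trans (hN.2 _ _ (pre_prefix_pre (le_max_right _ _)))))⟩
  rw [inter_pre]
  exact pre_prefix_pre (by omega)

/-- The sequence of the letters at even positions. -/
def evens (p : Cantor) : Cantor := fun n => p (2 * n)

/-- The sequence of the letters at odd positions. -/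
def odds (p : Cantor) : Cantor := fun n => p (2 * n + 1)

@[simp] theorem evens_pair (p q : Cantor) : evens (pair p q) = p := by
  funext n; simp [evens, pair]

@[simp] theorem odds_pair (p q : Cantor) : odds (pair p q) = q := by
  funext n
  have : (2 * n + 1) / 2 = n := by omega
  simp [odds, pair, this, Nat.add_mod]

theorem type2Computable_evens : Type2Computable (total evens) :=
  type2Computable_total (fun w m => bit w (2 * m)) (by fun_prop)
    fun p m => by rw [bit_pre (by omega)]; rfl

theorem type2Computable_odds : Type2Computable (total odds) :=
  type2Computable_total (fun w m => bit w (2 * m + 1)) (by fun_prop)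
    fun p m => by rw [bit_pre (by omega)]; rfl

theorem type2Computable_id : Type2Computable (total fun p => p) :=
  type2Computable_total (fun w m => bit w m) (by fun_prop)
    fun p m => by rw [bit_pre (by omega)]

/-! ### Weihrauch reducibility without realizers -/

theorem reducible_iff {f g : Problem} : Reducible f g ↔
    ∃ K H : Cantor →. Cantor, Type2Computable K ∧ Type2Computable H ∧
      ∀ p x, f.source.name p x → (f.fn x).Nonempty →
        ∃ r ∈ H p, ∃ y, g.source.name r y ∧ (g.fn y).Nonempty ∧
          ∀ s, ∀ z ∈ g.fn y, g.target.name s z →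
            ∃ q ∈ K (pair p s), ∃ z' ∈ f.fn x, f.target.name q z' := by
  classical
  refine exists_congr fun K => exists_congr fun H => and_congr_right fun _ =>
    and_congr_right fun _ => ⟨fun h p x hp hx => ?_, fun h G hG p x hp hx => ?_⟩
  · let S : Cantor → Cantor → Prop := fun r s =>
      ∃ y, g.source.name r y ∧ ∃ z ∈ g.fn y, g.target.name s z
    -- This realizer is undefined off the names of points in the domain of g, so its being defined
    -- at `H p` shows that `H p` is such a name.
    let G : Cantor →. Cantor := fun r => ⟨∃ s, S r s, fun h => h.choose⟩
    have hG : Realizes G g.fn := by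
      rintro r y hr ⟨z, hz⟩
      obtain ⟨s, hs⟩ := g.target.name_surj z
      have hS : ∃ s, S r s := ⟨s, y, hr, z, hz, hs⟩
      obtain ⟨y', hr', hz'⟩ := hS.choose_spec
      cases g.source.name_unique _ _ _ hr hr'
      exact ⟨hS.choose, ⟨hS, rfl⟩, hz'⟩
    obtain ⟨q, hq, -⟩ := h G hG p x hp hx
    simp only [Part.mem_bind_iff] at hq
    obtain ⟨r, hr, s, ⟨⟨s', y, hry, z, hz, hsz⟩, -⟩, -⟩ := hq
    refine ⟨r, hr, y, hry, ⟨z, hz⟩, fun t z hz htz => ?_⟩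
    -- Redefining the realizer at the single name r makes an arbitrary name t of a solution its
    -- answer, so `K` must cope with every t.
    let G' : Cantor →. Cantor := fun r' => if r' = r then Part.some t else G r'
    have hG' : Realizes G' g.fn := by
      intro r' y' hr' hy'
      by_cases e : r' = r
      · subst e
        cases g.source.name_unique _ _ _ hry hr'
        exact ⟨t, by simp [G'], z, hz, htz⟩
      · simpa [G', e] using hG r' y' hr' hy'
    obtain ⟨q, hq, hz'⟩ := h G' hG' p x hp hx
    simp only [Part.mem_bind_iff] at hq
    obtain ⟨r₁, hr₁, s₁, hs₁, hq⟩ := hq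
    cases Part.mem_unique hr hr₁
    have : s₁ = t := by simpa [G'] using hs₁
    subst this
    exact ⟨q, hq, hz'⟩
  · obtain ⟨r, hr, y, hry, hy, H⟩ := h p x hp hx
    obtain ⟨s, hs, z, hz, hsz⟩ := hG r y hry hy
    obtain ⟨q, hq, hz'⟩ := H s z hz hsz
    exact ⟨q, by simp only [Part.mem_bind_iff]; exact ⟨r, hr, s, hs, hq⟩, hz'⟩

theorem Reducible.of_total {f g : Problem} {K H : Cantor → Cantor}
    (hK : Type2Computable (total K)) (hH : Type2Computable (total H))
    (h : ∀ p x, f.source.name p x → (f.fn x).Nonempty →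
      ∃ y, g.source.name (H p) y ∧ (g.fn y).Nonempty ∧
        ∀ s, ∀ z ∈ g.fn y, g.target.name s z →
          ∃ z' ∈ f.fn x, f.target.name (K (Weihrauch.pair p s)) z') : Reducible f g :=
  reducible_iff.2 ⟨_, _, hK, hH, fun p x hp hx => ⟨_, mem_total.2 rfl, by
    simpa only [mem_total, exists_eq_left] using h p x hp hx⟩⟩

theorem Reducible.refl (f : Problem) : Reducible f f :=
  .of_total type2Computable_odds type2Computable_id fun _ x hp hx =>
    ⟨x, hp, hx, fun _ z hz hs => ⟨z, hz, by simpa using hs⟩⟩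

theorem Equivalent.refl (f : Problem) : Equivalent f f := ⟨.refl f, .refl f⟩

theorem Reducible.trans {f g h : Problem} (hfg : Reducible f g) (hgh : Reducible g h) :
    Reducible f h := by
  obtain ⟨K₁, H₁, hK₁, hH₁, h₁⟩ := reducible_iff.1 hfg
  obtain ⟨K₂, H₂, hK₂, hH₂, h₂⟩ := reducible_iff.1 hgh
  have hc := hK₁.comp (type2Computable_evens.pair
    (hK₂.comp ((hH₁.comp type2Computable_evens).pair type2Computable_odds)))
  refine reducible_iff.2 ⟨_, _, hc, hH₂.comp hH₁, fun p x hp hx => ?_⟩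
  obtain ⟨r, hr, y, hry, hy, H⟩ := h₁ p x hp hx
  obtain ⟨t, ht, w, htw, hw, H'⟩ := h₂ r y hry hy
  refine ⟨t, Part.mem_bind hr ht, w, htw, hw, fun s z hz hsz => ?_⟩
  obtain ⟨q, hq, z', hz', hqz'⟩ := H' s z hz hsz
  obtain ⟨q', hq', z'', hz'', hqz''⟩ := H q z' hz' hqz'
  refine ⟨q', ?_, z'', hz'', hqz''⟩
  have e : total evens (Weihrauch.pair p s) = Part.some p := by simp [total]
  have o : total odds (Weihrauch.pair p s) = Part.some s := by simp [total]
  simp only [e, o, Part.bind_some]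
  exact Part.mem_bind (Part.mem_bind (Part.mem_bind
    (Part.mem_bind (Part.mem_bind (Part.mem_some p) hr) (Part.mem_some _)) hq)
    (Part.mem_some _)) hq'

/-! ### Convergence of words along a filter -/

section Approx

variable {α β : Type*} {l : Filter α}

/-- Along the filter `l`, the words `v a` start with arbitrarily long prefixes of `q`. -/
def Approx (l : Filter α) (v : α → List Bool) (q : Cantor) : Prop :=
  ∀ n, ∀ᶠ a in l, pre q n <+: v a

theorem Approx.machine {M : List Bool → List Bool} {p q : Cantor} {v : α → List Bool}
    (hv : Approx l v p) (hM : IsMachine M) (h : Computes M p q) :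
    Approx l (fun a => M (v a)) q := by
  intro n
  obtain ⟨k, hk⟩ := h n
  filter_upwards [hv k] with a ha
  exact hk.trans (hM.2 _ _ ha)

theorem Approx.inter {p q : Cantor} {u v : α → List Bool} (hu : Approx l u p)
    (hv : Approx l v q) : Approx l (fun a => inter (u a) (v a)) (pair p q) := by
  intro n
  filter_upwards [hu n, hv n] with a ha hb
  refine List.IsPrefix.trans ?_ (inter_mono ha hb)
  rw [inter_pre]
  exact pre_prefix_pre (by omega)

theorem Approx.of_bits {X : α → ℕ → Bool} {L : α → ℕ} {q : Cantor} (hL : Tendsto L l atTop)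
    (hX : ∀ n, ∀ᶠ a in l, X a n = q n) : Approx l (fun a => pre (X a) (L a)) q := by
  intro n
  filter_upwards [hL.eventually_ge_atTop n,
    (eventually_all_finite (Set.finite_lt_nat n)).2 fun k _ => hX k] with a ha hb
  exact pre_prefix_pre_iff.2 ⟨ha, fun k hk => (hb k hk).symm⟩

theorem Approx.of_pre {L : α → ℕ} (p : Cantor) (hL : Tendsto L l atTop) :
    Approx l (fun a => pre p (L a)) p :=
  .of_bits hL fun _ => .of_forall fun _ => rfl

theorem Approx.comp {v : α → List Bool} {q : Cantor} (hv : Approx l v q) {m : Filter β}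
    {f : β → α} (hf : Tendsto f m l) : Approx m (fun b => v (f b)) q :=
  fun n => hf.eventually (hv n)

theorem Approx.congr {u v : α → List Bool} {q : Cantor} (hv : Approx l v q)
    (h : ∀ᶠ a in l, u a = v a) : Approx l u q := by
  intro n
  filter_upwards [hv n, h] with a ha hb
  rwa [hb]

theorem Approx.eventually_bit {v : α → List Bool} {q : Cantor} (hv : Approx l v q) (n : ℕ) :
    ∀ᶠ a in l, bit (v a) n = q n := by
  filter_upwards [hv (n + 1)] with a ha
  exact (pre_prefix_iff.1 ha).2 n (by omega)

theorem Approx.take_eq {v : α → List Bool} {q : Cantor} (hv : Approx l v q) (n : ℕ) :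
    ∀ᶠ a in l, (v a).take n = pre q n := by
  filter_upwards [hv n] with a ha
  simpa using (List.prefix_iff_eq_take.1 ha).symm

end Approx

/-- The filter of iterated limits `lim_{i → ∞} lim_{j → ∞}` on pairs `(i, j)`. -/
abbrev iter : Filter (ℕ × ℕ) := Filter.curry atTop atTop

theorem eventually_iter {P : ℕ × ℕ → Prop} :
    (∀ᶠ x in iter, P x) ↔ ∀ᶠ i in atTop, ∀ᶠ j in atTop, P (i, j) := eventually_curry_iff

theorem tendsto_snd_iter : Tendsto Prod.snd iter atTop :=
  fun _ hs => eventually_iter.2 (.of_forall fun _ => hs)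

/-! ### Limits on Cantor space -/

/-- Convergence `t(⟨n, i⟩) → q(n)` of a double sequence of bits. -/
def LimRel (t q : Cantor) : Prop := ∀ n, ∀ᶠ i in atTop, t (Nat.pair n i) = q n

theorem LimRel.unique {t q r : Cantor} (hq : LimRel t q) (hr : LimRel t r) : q = r := by
  funext n
  obtain ⟨i, h, h'⟩ := ((hq n).and (hr n)).exists
  exact h.symm.trans h'

/-- The limit map on Cantor space. -/
def limFn : MultiFun cantorSpace cantorSpace := fun t => {q | LimRel t q}

/-- The limit map on Cantor space as a problem. -/
def limCantor : Problem := ⟨cantorSpace, cantorSpace, limFn⟩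

/-- The twofold limit map on Cantor space as a problem. -/
def limLimCantor : Problem := ⟨cantorSpace, cantorSpace, limFn.comp limFn⟩

/-- Limits are unique, so the domain clause of the composition holds automatically. -/
theorem mem_comp_limFn {t z : Cantor} :
    z ∈ limFn.comp limFn t ↔ ∃ q : Cantor, LimRel t q ∧ LimRel q z := by
  refine ⟨fun ⟨_, q, hq, hz⟩ => ⟨q, hq, hz⟩, fun ⟨q, hq, hz⟩ => ⟨fun r hr => ?_, q, hq, hz⟩⟩
  cases LimRel.unique hq hr
  exact ⟨z, hz⟩

theorem mem_comp_limFn_unique {t y z : Cantor} (hy : y ∈ limFn.comp limFn t)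
    (hz : z ∈ limFn.comp limFn t) : y = z := by
  obtain ⟨u, hu, hy⟩ := mem_comp_limFn.1 hy
  obtain ⟨v, hv, hz⟩ := mem_comp_limFn.1 hz
  rw [hu.unique hv] at hy
  exact hy.unique hz

/-- A guess of the `n`-th limit, given a finite prefix of a double sequence. -/
def guess (v : List Bool) (n : ℕ) : Bool := bit v (Nat.pair n (Nat.sqrt v.length - 1))

@[fun_prop] theorem computable_guess {α : Type*} [Primcodable α] {f : α → List Bool} {g : α → ℕ}
    (hf : Computable f) (hg : Computable g) : Computable (fun a => guess (f a) (g a)) := by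
  unfold guess; fun_prop

theorem tendsto_sqrt_sub_one : Tendsto (fun n => Nat.sqrt n - 1) atTop atTop := by
  refine tendsto_atTop.2 fun m => ?_
  filter_upwards [eventually_ge_atTop ((m + 1) * (m + 1))] with n hn
  have := Nat.le_sqrt.2 hn
  omega

/-- A pair ⟨n, i⟩ is below (max n i + 1)². With i = √k - 1 ≥ n this bound is (√k)² ≤ k, so the stage
used by `guess` lies inside the word. -/
theorem eventually_pair_sqrt_lt (n : ℕ) :
    ∀ᶠ k in atTop, Nat.pair n (Nat.sqrt k - 1) < k := by
  filter_upwards [tendsto_sqrt_sub_one.eventually_ge_atTop n, eventually_ge_atTop 1] with k hk h1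
  have hs : 1 ≤ Nat.sqrt k := Nat.le_sqrt.2 h1
  have h := Nat.pair_lt_max_add_one_sq n (Nat.sqrt k - 1)
  rw [max_eq_right hk, Nat.sub_add_cancel hs] at h
  exact h.trans_le (Nat.sqrt_le' k)

theorem LimRel.eventually_guess {α : Type*} {l : Filter α} {t q : Cantor} (h : LimRel t q)
    {L : α → ℕ} (hL : Tendsto L l atTop) (n : ℕ) :
    ∀ᶠ a in l, guess (pre t (L a)) n = q n := by
  filter_upwards [hL.eventually (eventually_pair_sqrt_lt n),
    (tendsto_sqrt_sub_one.comp hL).eventually (h n)] with a ha hb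
  rw [guess, length_pre, bit_pre ha]
  exact hb

/-! ### Degrees below lim and lim ∘ lim in terms of words -/

/-- The values of `f` have names which are limits of words computed from the input. -/
def LimComputable (f : Problem) : Prop :=
  ∃ C : List Bool → List Bool, Computable C ∧
    ∀ p x, f.source.name p x → (f.fn x).Nonempty → ∃ q, (∃ y ∈ f.fn x, f.target.name q y) ∧
      Approx atTop (fun j => C (pre p j)) q

/-- The values of `f` have names which are iterated limits of words computed from the input. -/
def LimLimComputable (f : Problem) : Prop :=
  ∃ C : List Bool × ℕ → List Bool, Computable C ∧
    ∀ p x, f.source.name p x → (f.fn x).Nonempty → ∃ q, (∃ y ∈ f.fn x, f.target.name q y) ∧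
      Approx iter (fun x => C (pre p x.2, x.1)) q

/-- The machine for `K` is run on the input paired with the current guesses of the limits. Each
output prefix depends on finitely many guessed bits, which are eventually right. -/
theorem Reducible.limComputable {f : Problem} (h : Reducible f limCantor) : LimComputable f := by
  obtain ⟨K, H, hK, hH, h⟩ := reducible_iff.1 h
  obtain ⟨M, hM, HM⟩ := type2Computable_iff.1 hK
  obtain ⟨N, hN, HN⟩ := type2Computable_iff.1 hH
  have hMc := hM.1
  have hNc := hN.1
  refine ⟨fun w => M (inter w (pre (guess (N w)) (N w).length)), by fun_prop, fun p x hp hx => ?_⟩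
  obtain ⟨_, hr, t, rfl, ⟨s, hs⟩, H⟩ := h p x hp hx
  obtain ⟨q, hq, z, hz, hqz⟩ := H s s hs rfl
  obtain ⟨L, hL, hNL⟩ := (HN _ _ hr).exists_length hN
  refine ⟨q, ⟨z, hz, hqz⟩, Approx.machine (.inter (.of_pre p tendsto_id) ?_) hM (HM _ _ hq)⟩
  simp only [hNL, length_pre]
  exact .of_bits hL fun n => LimRel.eventually_guess hs hL n

theorem Reducible.limLimComputable {f : Problem} (h : Reducible f limLimCantor) :
    LimLimComputable f := by
  obtain ⟨K, H, hK, hH, h⟩ := reducible_iff.1 h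
  obtain ⟨M, hM, HM⟩ := type2Computable_iff.1 hK
  obtain ⟨N, hN, HN⟩ := type2Computable_iff.1 hH
  have hMc := hM.1
  have hNc := hN.1
  refine ⟨fun x => M (inter x.1 (pre (fun n => guess (N x.1) (Nat.pair n x.2)) (N x.1).length)),
    by fun_prop, fun p x hp hx => ?_⟩
  obtain ⟨_, hr, t, rfl, ⟨s, hs⟩, H⟩ := h p x hp hx
  obtain ⟨q, hq, z, hz, hqz⟩ := H s s hs rfl
  obtain ⟨u, hu, hs⟩ := mem_comp_limFn.1 hs
  obtain ⟨L, hL, hNL⟩ := (HN _ _ hr).exists_length hN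
  refine ⟨q, ⟨z, hz, hqz⟩,
    Approx.machine (.inter (.of_pre p tendsto_snd_iter) ?_) hM (HM _ _ hq)⟩
  simp only [hNL, length_pre]
  refine .of_bits (hL.comp tendsto_snd_iter) fun n => eventually_iter.2 ?_
  filter_upwards [hs n] with i hi
  filter_upwards [LimRel.eventually_guess hu hL (Nat.pair n i)] with j hj
  rw [hj, hi]

theorem LimComputable.reducible {f : Problem} (h : LimComputable f) : Reducible f limCantor := by
  obtain ⟨C, hC, h⟩ := h
  refine .of_total type2Computable_odds
    (H := fun p m => bit (C (pre p m.unpair.2)) m.unpair.1)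
    (type2Computable_total (fun w m => bit (C (w.take m.unpair.2)) m.unpair.1) (by fun_prop)
      fun p m => ?_) fun p x hp hx => ?_
  · rw [take_pre (by have := Nat.unpair_right_le m; omega)]
  · obtain ⟨q, ⟨y, hy, hqy⟩, hq⟩ := h p x hp hx
    have hl : LimRel (fun m => bit (C (pre p m.unpair.2)) m.unpair.1) q := fun n => by
      simpa using hq.eventually_bit n
    refine ⟨_, rfl, ⟨q, hl⟩, ?_⟩
    rintro _ z hz rfl
    cases LimRel.unique hl hz
    exact ⟨y, hy, by simpa using hqy⟩

/-! ### Making all inner limits exist -/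

/-- Whether the `n`-th bit of the `k`-th approximation does not change from stage `i` on, as far as
the word `w` tells. -/
def stable (B : List Bool × ℕ × ℕ → Bool) (w : List Bool) (n k i : ℕ) : Bool :=
  Nat.rec true (fun l b => b && (decide (l < i) || decide (B (w.take l, n, k) = B (w.take i, n, k))))
    (w.length + 1)

/-- The value at stage `i` of the last among the first `i + 1` approximations that is stable from
stage `i` on, as far as the word `w` tells. -/
def regularize (B : List Bool × ℕ × ℕ → Bool) (w : List Bool) (n i : ℕ) : Bool :=
  Nat.rec false (fun k b => if stable B w n k i = true then B (w.take i, n, k) else b) (i + 1)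

@[fun_prop] theorem computable_stable {B : List Bool × ℕ × ℕ → Bool} (hB : Computable B)
    {α : Type*} [Primcodable α] {w : α → List Bool} {n k i : α → ℕ} (hw : Computable w)
    (hn : Computable n) (hk : Computable k) (hi : Computable i) :
    Computable fun a => stable B (w a) (n a) (k a) (i a) := by
  unfold stable
  exact computable_nat_rec (z := fun _ => true) (n := fun a => (w a).length + 1)
    (s := fun a l b => b && (decide (l < i a) ||
      decide (B ((w a).take l, n a, k a) = B ((w a).take (i a), n a, k a))))
    (by fun_prop) (by fun_prop) (by fun_prop)

@[fun_prop] theorem computable_regularize {B : List Bool × ℕ × ℕ → Bool} (hB : Computable B)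
    {α : Type*} [Primcodable α] {w : α → List Bool} {n i : α → ℕ} (hw : Computable w)
    (hn : Computable n) (hi : Computable i) :
    Computable fun a => regularize B (w a) (n a) (i a) := by
  unfold regularize
  exact computable_nat_rec (z := fun _ => false) (n := fun a => i a + 1)
    (s := fun a k b => if stable B (w a) (n a) k (i a) = true then
      B ((w a).take (i a), n a, k) else b) (by fun_prop) (by fun_prop) (by fun_prop)

theorem stable_iff {B : List Bool × ℕ × ℕ → Bool} {w : List Bool} {n k i : ℕ} :
    stable B w n k i = true ↔
      ∀ l ≤ w.length, i ≤ l → B (w.take l, n, k) = B (w.take i, n, k) := by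
  suffices ∀ m, (Nat.rec (motive := fun _ => Bool) true (fun l b => b && (decide (l < i) ||
      decide (B (w.take l, n, k) = B (w.take i, n, k)))) m) = true ↔
      ∀ l < m, i ≤ l → B (w.take l, n, k) = B (w.take i, n, k) by
    refine (this (w.length + 1)).trans ?_
    simp only [Nat.lt_succ_iff]
  intro m
  induction m with
  | zero => simp
  | succ m ih =>
    simp only [Bool.and_eq_true, ih, Bool.or_eq_true, decide_eq_true_eq, Nat.lt_succ_iff_lt_or_eq]
    constructor
    · rintro ⟨h1, h2⟩ l (hl | rfl) hi
      · exact h1 l hl hi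
      · exact h2.resolve_left (by omega)
    · intro h
      refine ⟨fun l hl => h l (.inl hl), ?_⟩
      by_cases hm : m < i
      · exact .inl hm
      · exact .inr (h m (.inr rfl) (by omega))

theorem eventually_stable_iff (B : List Bool × ℕ × ℕ → Bool) (p : Cantor) (n k i : ℕ) :
    ∀ᶠ j in atTop, (stable B (pre p j) n k i = true ↔
      ∀ l ≥ i, B (pre p l, n, k) = B (pre p i, n, k)) := by
  by_cases h : ∀ l ≥ i, B (pre p l, n, k) = B (pre p i, n, k)
  · filter_upwards [eventually_ge_atTop i] with j hj
    refine iff_of_true (stable_iff.2 fun l hl hi => ?_) h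
    rw [length_pre] at hl
    rw [take_pre hl, take_pre hj, h l hi]
  · push Not at h
    obtain ⟨l, hl, hne⟩ := h
    filter_upwards [eventually_ge_atTop l] with j hj
    refine iff_of_false (fun hs => hne ?_) (fun hs => hne (hs l hl))
    have := stable_iff.1 hs l (by simpa) hl
    rwa [take_pre hj, take_pre (by omega)] at this

/-- Only the approximations k ≤ i are consulted, and the verdict on the stability of each settles,
since instability is witnessed at a finite stage. No convergence of `B` is needed. -/
theorem exists_eventually_regularize (B : List Bool × ℕ × ℕ → Bool) (p : Cantor) (n i : ℕ) :
    ∃ b, ∀ᶠ j in atTop, regularize B (pre p j) n i = b := by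
  unfold regularize
  induction i + 1 with
  | zero => exact ⟨false, .of_forall fun _ => rfl⟩
  | succ m ih =>
    obtain ⟨b, hb⟩ := ih
    by_cases h : ∀ l ≥ i, B (pre p l, n, m) = B (pre p i, n, m)
    · refine ⟨B (pre p i, n, m), ?_⟩
      filter_upwards [eventually_stable_iff B p n m i, eventually_ge_atTop i] with j hj hi
      simp only [hj.2 h, if_true, take_pre hi]
    · refine ⟨b, ?_⟩
      filter_upwards [eventually_stable_iff B p n m i, hb] with j hj hb
      rw [if_neg (mt hj.1 h)]
      exact hb

theorem eventually_regularize {B : List Bool × ℕ × ℕ → Bool} {p : Cantor} {n : ℕ} {b : Bool}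
    (h : ∀ᶠ i in atTop, ∀ᶠ j in atTop, B (pre p j, n, i) = b) :
    ∀ᶠ i in atTop, ∀ᶠ j in atTop, regularize B (pre p j) n i = b := by
  obtain ⟨K, hK⟩ := eventually_atTop.1 h
  obtain ⟨J, hJ⟩ := eventually_atTop.1 (hK K le_rfl)
  -- All approximations from `K` on have inner limit b, and the `K`-th has reached it by stage `J`.
  -- So for these i some k ≥ K is stable from i on, and every such stable k has value b, in
  -- particular the last one.
  filter_upwards [eventually_ge_atTop K, eventually_ge_atTop J] with i hiK hiJ
  suffices ∀ m ≥ K, ∀ᶠ j in atTop, (Nat.rec (motive := fun _ => Bool) false (fun k b =>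
      if stable B (pre p j) n k i = true then B ((pre p j).take i, n, k) else b) (m + 1)) = b from
    this i hiK
  intro m hm
  induction m, hm using Nat.le_induction with
  | base =>
    filter_upwards [eventually_stable_iff B p n K i, eventually_ge_atTop i] with j hj hi
    have hs : ∀ l ≥ i, B (pre p l, n, K) = B (pre p i, n, K) := fun l hl => by
      rw [hJ l (hiJ.trans hl), hJ i hiJ]
    simp only [hj.2 hs, if_true, take_pre hi, hJ i hiJ]
  | succ m hm ih =>
    by_cases hs : ∀ l ≥ i, B (pre p l, n, m + 1) = B (pre p i, n, m + 1)
    · have hv : B (pre p i, n, m + 1) = b := by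
        obtain ⟨j, hj, hi⟩ := ((hK (m + 1) (by omega)).and (eventually_ge_atTop i)).exists
        rw [← hs j hi, hj]
      filter_upwards [eventually_stable_iff B p n (m + 1) i, eventually_ge_atTop i] with j hj hi
      simp only [hj.2 hs, if_true, take_pre hi, hv]
    · filter_upwards [eventually_stable_iff B p n (m + 1) i, ih] with j hj hb
      rw [if_neg (mt hj.1 hs)]
      exact hb

theorem LimLimComputable.reducible {f : Problem} (h : LimLimComputable f) :
    Reducible f limLimCantor := by
  obtain ⟨C, hC, h⟩ := h
  let B : List Bool × ℕ × ℕ → Bool := fun x => bit (C (x.1, x.2.2)) x.2.1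
  have hB : Computable B := by fun_prop
  refine .of_total type2Computable_odds
    (H := fun p m => regularize B (pre p m.unpair.2) m.unpair.1.unpair.1 m.unpair.1.unpair.2)
    (type2Computable_total (fun w m => regularize B (w.take m.unpair.2) m.unpair.1.unpair.1
      m.unpair.1.unpair.2) (by fun_prop) fun p m => ?_) fun p x hp hx => ?_
  · rw [take_pre (by have := Nat.unpair_right_le m; omega)]
  · obtain ⟨q, ⟨y, hy, hqy⟩, hq⟩ := h p x hp hx
    -- The intermediate sequence: u⟨n, i⟩ is the inner limit, which exists for every i, even where
    -- that of `B` does not.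
    choose u hu using fun m : ℕ =>
      exists_eventually_regularize B p m.unpair.1 m.unpair.2
    have hl : q ∈ limFn.comp limFn (fun m => regularize B (pre p m.unpair.2)
        m.unpair.1.unpair.1 m.unpair.1.unpair.2) := mem_comp_limFn.2 ⟨u, fun m => by
      simpa only [Nat.unpair_pair] using hu m, fun n => by
      filter_upwards [eventually_regularize (B := B) (eventually_iter.1 (hq.eventually_bit n))]
        with i hi
      obtain ⟨j, h1, h2⟩ := (hi.and (hu (Nat.pair n i))).exists
      simp only [Nat.unpair_pair] at h2
      rw [← h2, h1]⟩
    refine ⟨_, rfl, ⟨q, hl⟩, ?_⟩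
    rintro _ z hz rfl
    cases mem_comp_limFn_unique hl hz
    exact ⟨y, hy, by simpa using hqy⟩

/-! ### Coding Baire space: lim on Baire and on Cantor space are equivalent -/

open Classical in
/-- The unique name of a point of Baire space. -/
noncomputable def baireName (a : ℕ → ℕ) : Cantor := fun k => decide (∃ n, onePos a n = k)

theorem baireSpace_name_iff {p : Cantor} {a : ℕ → ℕ} :
    baireSpace.name p a ↔ p = baireName a := by
  constructor
  · intro h
    funext k
    rw [Bool.eq_iff_iff, h k]
    simp [baireName]
  · rintro rfl k
    simp [baireName]

/-- The word `0^{a(0)} 1 … 0^{a(n)} 1` encoding a list `[a(0), …, a(n)]` of natural numbers. -/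
def enc (l : List ℕ) : List Bool := l.flatMap fun a => (List.range a).map (fun _ => false) ++ [true]

theorem primrec_enc : Primrec enc :=
  Primrec.list_flatMap Primrec.id (Primrec.list_append.comp
    (Primrec.list_map (Primrec.list_range.comp Primrec.snd) (Primrec.const false))
    (Primrec.const [true]))

@[fun_prop] theorem computable_enc {α : Type*} [Primcodable α] {f : α → List ℕ}
    (hf : Computable f) : Computable (fun a => enc (f a)) := primrec_enc.to_comp.comp hf

theorem enc_mono {u v : List ℕ} (h : u <+: v) : enc u <+: enc v := by
  obtain ⟨t, rfl⟩ := h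
  exact ⟨enc t, by simp [enc]⟩

theorem enc_range_map (a : ℕ → ℕ) (n : ℕ) :
    enc ((List.range n).map a) = pre (baireName a) ((∑ i ∈ Finset.range n, a i) + n) := by
  induction n with
  | zero => rfl
  | succ n ih =>
    have h1 : enc ((List.range (n + 1)).map a) =
        enc ((List.range n).map a) ++ ((List.range (a n)).map (fun _ => false) ++ [true]) := by
      simp [enc, List.range_succ]
    have h2 : (∑ i ∈ Finset.range (n + 1), a i) + (n + 1) =
        ((∑ i ∈ Finset.range n, a i) + n) + (a n + 1) := by
      rw [Finset.sum_range_succ]; omega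
    have hpos : onePos a n = ((∑ i ∈ Finset.range n, a i) + n) + a n := by
      rw [onePos, Finset.sum_range_succ]; omega
    rw [h1, ih, h2]
    generalize hN : (∑ i ∈ Finset.range n, a i) + n = N at hpos ⊢
    unfold pre
    rw [List.range_add, List.map_append, List.range_succ (n := a n), List.map_append,
      List.map_append]
    congr 2
    · rw [List.map_map]
      refine List.map_congr_left fun k hk => ?_
      rw [List.mem_range] at hk
      symm
      simp only [baireName, Function.comp, decide_eq_false_iff_not]
      rintro ⟨m, hm⟩
      rcases lt_or_ge m n with h | h
      · have : onePos a m < (∑ i ∈ Finset.range n, a i) + n := by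
          unfold onePos
          have := Finset.sum_le_sum_of_subset (f := a)
            (Finset.range_subset_range.2 (Nat.succ_le_of_lt h))
          simp only [Nat.succ_eq_add_one] at this
          omega
        omega
      · have := (onePos_strictMono a).monotone h
        omega
    · simp only [List.map_cons, List.map_nil, List.cons.injEq, and_true]
      symm
      simp only [baireName, decide_eq_true_eq]
      exact ⟨n, hpos⟩

theorem pre_baireName_prefix (a : ℕ → ℕ) (n : ℕ) :
    pre (baireName a) n <+: enc ((List.range n).map a) := by
  rw [enc_range_map]
  exact pre_prefix_pre (by omega)

/-- One step of decoding: the completed entries, and the number of pending zeros. -/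
def decStep (s : List ℕ × ℕ) (b : Bool) : List ℕ × ℕ :=
  if b = true then (s.1 ++ [s.2], 0) else (s.1, s.2 + 1)

/-- The list of natural numbers encoded by a prefix of a name in Baire space. -/
def dec (w : List Bool) : List ℕ := (w.foldl decStep ([], 0)).1

theorem primrec_decStep : Primrec₂ decStep :=
  Primrec.ite (Primrec.eq.comp Primrec.snd (Primrec.const true))
    (Primrec.pair (Primrec.list_concat.comp (Primrec.fst.comp Primrec.fst)
      (Primrec.snd.comp Primrec.fst)) (Primrec.const 0))
    (Primrec.pair (Primrec.fst.comp Primrec.fst)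
      (Primrec.succ.comp (Primrec.snd.comp Primrec.fst)))

theorem primrec_dec : Primrec dec :=
  Primrec.fst.comp (Primrec.list_foldl Primrec.id (Primrec.const ([], 0))
    (primrec_decStep.comp (Primrec.fst.comp Primrec.snd) (Primrec.snd.comp Primrec.snd)).to₂)

@[fun_prop] theorem computable_dec {α : Type*} [Primcodable α] {f : α → List Bool}
    (hf : Computable f) : Computable (fun a => dec (f a)) := primrec_dec.to_comp.comp hf

theorem foldl_decStep_prefix (w : List Bool) (s : List ℕ × ℕ) :
    s.1 <+: (w.foldl decStep s).1 := by
  induction w generalizing s with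
  | nil => exact List.prefix_rfl
  | cons b w ih =>
    refine List.IsPrefix.trans ?_ (ih (decStep s b))
    cases b <;> simp [decStep]

theorem dec_mono {u v : List Bool} (h : u <+: v) : dec u <+: dec v := by
  obtain ⟨t, rfl⟩ := h
  rw [dec, dec, List.foldl_append]
  exact foldl_decStep_prefix _ _

theorem dec_enc (l : List ℕ) : dec (enc l) = l := by
  have h1 : ∀ (n : ℕ) (s : List ℕ × ℕ),
      ((List.range n).map fun _ => false).foldl decStep s = (s.1, s.2 + n) := by
    intro n s
    induction n with
    | zero => rfl
    | succ n ih => 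
      rw [List.range_succ, List.map_append, List.foldl_append, ih]
      simp [decStep, add_assoc]
  suffices ∀ m, (enc l).foldl decStep (m, 0) = (m ++ l, 0) by simp [dec, this]
  induction l with
  | nil => simp [enc]
  | cons a l ih =>
    intro m
    have : enc (a :: l) = ((List.range a).map (fun _ => false) ++ [true]) ++ enc l := by simp [enc]
    rw [this, List.foldl_append, List.foldl_append, h1, List.foldl_cons, List.foldl_nil]
    simp only [decStep, if_true]
    rw [ih]
    simp

theorem range_map_prefix {β : Type*} {f g : ℕ → β} {m n : ℕ} (h : m ≤ n)
    (H : ∀ k < m, f k = g k) : (List.range m).map f <+: (List.range n).map g := by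
  obtain ⟨d, rfl⟩ := Nat.exists_eq_add_of_le h
  refine ⟨(List.range d).map fun i => g (m + i), ?_⟩
  rw [List.range_add, List.map_append, List.map_map]
  congr 1
  exact List.map_congr_left fun k hk => H k (List.mem_range.1 hk)

theorem exists_dec_pre_baireName (a : ℕ → ℕ) :
    ∃ L : ℕ → ℕ, Tendsto L atTop atTop ∧
      ∀ k, dec (pre (baireName a) k) = (List.range (L k)).map a := by
  have key : ∀ n k, (∑ i ∈ Finset.range n, a i) + n ≤ k →
      (List.range n).map a <+: dec (pre (baireName a) k) := fun n k hk => by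
    rw [← dec_enc ((List.range n).map a), enc_range_map]
    exact dec_mono (pre_prefix_pre hk)
  refine ⟨fun k => (dec (pre (baireName a) k)).length, tendsto_atTop.2 fun n => ?_, fun k => ?_⟩
  · filter_upwards [eventually_ge_atTop ((∑ i ∈ Finset.range n, a i) + n)] with k hk
    simpa using (key n k hk).length_le
  · set n := (dec (pre (baireName a) k)).length with hn
    have h1 := key n _ (le_max_right k _)
    have h2 := dec_mono (pre_prefix_pre (p := baireName a)
      (le_max_left k ((∑ i ∈ Finset.range n, a i) + n)))
    exact (List.prefix_of_prefix_length_le h2 h1 (by simp [hn])).eq_of_length (by simp [hn])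

theorem mem_limProblem_fn {a b : ℕ → ℕ} :
    b ∈ limProblem.fn a ↔ ∀ n, ∀ᶠ i in atTop, a (Nat.pair n i) = b n := by
  change (∀ n, Tendsto (fun i => a (Nat.pair n i)) atTop (𝓝 (b n))) ↔ _
  simp only [nhds_discrete, tendsto_pure]

theorem limProblem_limComputable : LimComputable limProblem := by
  refine ⟨fun w => enc ((List.range (dec w).length).map fun n =>
    (dec w).getD (Nat.pair n (Nat.sqrt (dec w).length - 1)) 0), by fun_prop, ?_⟩
  rintro p (a : ℕ → ℕ) hp ⟨(b : ℕ → ℕ), hb⟩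
  cases baireSpace_name_iff.1 hp
  refine ⟨baireName b, ⟨b, hb, baireSpace_name_iff.2 rfl⟩, fun n => ?_⟩
  obtain ⟨L, hL, h⟩ := exists_dec_pre_baireName a
  filter_upwards [hL.eventually_ge_atTop n,
    (eventually_all_finite (Set.finite_lt_nat n)).2 fun k _ =>
      ((tendsto_sqrt_sub_one.comp hL).eventually (mem_limProblem_fn.1 hb k)).and
        (hL.eventually (eventually_pair_sqrt_lt k))] with j hj hv
  refine (pre_baireName_prefix b n).trans (enc_mono (range_map_prefix ?_ fun k hk => ?_))
  · simpa [h]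
  · obtain ⟨h1, h2⟩ := hv k hk
    rw [← h1, h]
    simp [List.getD_eq_getElem?_getD, h2]

theorem limCantor_reducible_limProblem : Reducible limCantor limProblem := by
  -- Decoding must be partial: a sequence with finitely many ones would yield only finitely many
  -- entries.
  let D : Cantor →. Cantor := fun s =>
    ⟨∃ b, s = baireName b, fun h n => decide (h.choose n = 1)⟩
  have hD : Type2Computable D := by
    refine type2Computable_iff.2 ⟨fun w => pre (fun n => decide ((dec w).getD n 0 = 1))
      (dec w).length, ⟨by fun_prop, fun u v h => ?_⟩, ?_⟩
    · obtain ⟨t, ht⟩ := dec_mono h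
      beta_reduce
      rw [← ht]
      refine range_map_prefix (by simp) fun k hk => ?_
      simp [List.getD_eq_getElem?_getD, List.getElem?_append_left hk]
    · rintro s q ⟨hs, rfl⟩ n
      have hs' := hs.choose_spec
      obtain ⟨L, hL, h⟩ := exists_dec_pre_baireName hs.choose
      rw [← hs'] at h
      obtain ⟨k, hk⟩ := (hL.eventually_ge_atTop n).exists
      refine ⟨k, ?_⟩
      simp only [h]
      refine range_map_prefix (by simpa) fun m hm => ?_
      simp [List.getD_eq_getElem?_getD, hm.trans_le hk, D]
  let e : Cantor → ℕ → ℕ := fun t n => if t n = true then 1 else 0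
  have hE : Type2Computable (total fun t => baireName (e t)) :=
    type2Computable_total (fun w m => bit (enc ((List.range (m + 1)).map
      fun n => if bit w n = true then 1 else 0)) m) (by fun_prop) fun t m => by
        -- Every entry contributes at least its final 1, so m + 1 entries already determine letter m
        -- of the name.
        have := (pre_prefix_iff.1 (pre_baireName_prefix (e t) (m + 1))).2 m (by omega)
        rw [← this]
        congr 2
        refine List.map_congr_left fun k hk => ?_
        rw [List.mem_range] at hk
        rw [bit_pre (by omega)]
  refine reducible_iff.2 ⟨_, _, hD.comp type2Computable_odds, hE, ?_⟩
  rintro t _ rfl ⟨(q : Cantor), hq⟩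
  refine ⟨_, mem_total.2 rfl, e t, baireSpace_name_iff.2 rfl, ⟨e q, mem_limProblem_fn.2 fun n => ?_⟩,
    fun s (b : ℕ → ℕ) hb hs => ?_⟩
  · filter_upwards [hq n] with i hi
    simp [e, hi]
  · cases baireSpace_name_iff.1 hs
    have hdom : ∃ b', baireName b = baireName b' := ⟨b, rfl⟩
    have hch : hdom.choose = b := baireSpace.name_unique _ _ _
      (baireSpace_name_iff.2 hdom.choose_spec) (baireSpace_name_iff.2 rfl)
    refine ⟨fun n => decide (hdom.choose n = 1), Part.mem_bind (mem_total.2 rfl) ?_,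
      fun n => decide (hdom.choose n = 1), fun n => ?_, rfl⟩
    · rw [odds_pair]
      exact ⟨hdom, rfl⟩
    · filter_upwards [mem_limProblem_fn.1 hb n] with i hi
      rw [hch, ← hi]
      cases h : t (Nat.pair n i) <;> simp [e, h]

theorem limCantor_equivalent_limProblem : Equivalent limCantor limProblem :=
  ⟨limCantor_reducible_limProblem, limProblem_limComputable.reducible⟩

/-! ### Counting zeros: Sort as an iterated limit -/

open Classical in
/-- The number of zeros of `s` plus one, or `0` if there are infinitely many. -/
noncomputable def zeroCode (s : Cantor) : ℕ :=
  if {i | s i = false}.Finite then {i | s i = false}.ncard + 1 else 0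

/-- The sorted sequence `0^n 1^ω` for `h = n + 1`, and `0^ω` for `h = 0`. -/
def sorted (h : ℕ) : Cantor := fun k => decide (0 < h) && decide (h ≤ k + 1)

@[fun_prop] theorem computable_sorted {α : Type*} [Primcodable α] {f g : α → ℕ}
    (hf : Computable f) (hg : Computable g) : Computable (fun a => sorted (f a) (g a)) := by
  unfold sorted; fun_prop

theorem sortSeq_eq_sorted (s : Cantor) : sortSeq s = sorted (zeroCode s) := by
  unfold sortSeq zeroCode sorted
  split_ifs <;> simp

/-- The number of zeros in a word. -/
def zeros (w : List Bool) : ℕ := Nat.rec 0 (fun k c => if bit w k = false then c + 1 else c) w.length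

@[fun_prop] theorem computable_zeros {α : Type*} [Primcodable α] {f : α → List Bool}
    (hf : Computable f) : Computable (fun a => zeros (f a)) :=
  computable_nat_rec (z := fun _ => 0) (n := fun a => (f a).length)
    (s := fun a k c => if bit (f a) k = false then c + 1 else c)
    (by fun_prop) (by fun_prop) (by fun_prop)

theorem zeros_pre (s : Cantor) (j : ℕ) : zeros (pre s j) = Nat.count (fun k => s k = false) j := by
  suffices ∀ m ≤ j, (Nat.rec (motive := fun _ => ℕ) 0
      (fun k c => if bit (pre s j) k = false then c + 1 else c) m) =
      Nat.count (fun k => s k = false) m by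
    simpa [zeros] using this j le_rfl
  intro m hm
  induction m with
  | zero => simp
  | succ m ih =>
    simp only [ih (by omega), bit_pre (show m < j by omega), Nat.count_succ]
    split_ifs <;> rfl

theorem eventually_zeros_of_finite {s : Cantor} (hs : {i | s i = false}.Finite) :
    ∀ᶠ j in atTop, zeros (pre s j) = {i | s i = false}.ncard := by
  obtain ⟨N, hN⟩ := hs.bddAbove
  filter_upwards [eventually_gt_atTop N] with j hj
  rw [zeros_pre, Nat.count_eq_card_filter_range, ← Set.ncard_coe_finset]
  congr 1
  ext i
  have : s i = false → i ≤ N := fun hi => hN hi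
  simp
  intro hi
  have := this hi
  omega

theorem tendsto_zeros_of_infinite {s : Cantor} (hs : ¬ {i | s i = false}.Finite) :
    Tendsto (fun j => zeros (pre s j)) atTop atTop := by
  refine tendsto_atTop.2 fun n => ?_
  filter_upwards [eventually_ge_atTop (Nat.nth (fun k => s k = false) n)] with j hj
  rw [zeros_pre]
  calc n = Nat.count (fun k => s k = false) (Nat.nth (fun k => s k = false) n) :=
        (Nat.count_nth_of_infinite hs n).symm
    _ ≤ _ := Nat.count_monotone _ hj

/-- The guess at stage `i` of the number of zeros, given a prefix of the sequence. -/
def zeroGuess (w : List Bool) (i : ℕ) : ℕ := if i < zeros w then 0 else zeros w + 1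

@[fun_prop] theorem computable_zeroGuess {α : Type*} [Primcodable α] {f : α → List Bool}
    {g : α → ℕ} (hf : Computable f) (hg : Computable g) :
    Computable (fun a => zeroGuess (f a) (g a)) := by
  unfold zeroGuess; fun_prop

/-- A finite count c is found once i ≥ c, while smaller i wrongly report infinity; an infinite count
eventually exceeds every i. Hence two limits, in this order. -/
theorem eventually_zeroGuess (s : Cantor) {L : ℕ → ℕ} (hL : Tendsto L atTop atTop) :
    ∀ᶠ i in atTop, ∀ᶠ j in atTop, zeroGuess (pre s (L j)) i = zeroCode s := by
  by_cases hs : {i | s i = false}.Finite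
  · filter_upwards [eventually_ge_atTop {i | s i = false}.ncard] with i hi
    filter_upwards [hL.eventually (eventually_zeros_of_finite hs)] with j hj
    rw [zeroGuess, zeroCode, hj, if_neg (by omega), if_pos hs]
  · refine .of_forall fun i => ?_
    filter_upwards [((tendsto_zeros_of_infinite hs).comp hL).eventually_gt_atTop i] with j hj
    exact (if_pos hj).trans (if_neg hs).symm

/-- The index `h` of a sorted sequence `sorted h`, guessed from a prefix. -/
def sortedCode (w : List Bool) : ℕ := if zeros w < w.length then zeros w + 1 else 0

@[fun_prop] theorem computable_sortedCode {α : Type*} [Primcodable α] {f : α → List Bool}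
    (hf : Computable f) : Computable (fun a => sortedCode (f a)) := by
  unfold sortedCode; fun_prop

/-- On an already sorted sequence one limit suffices: 0 is reported until a 1 appears, and then the
count of zeros is final. -/
theorem eventually_sortedCode (h : ℕ) : ∀ᶠ j in atTop, sortedCode (pre (sorted h) j) = h := by
  cases h with
  | zero =>
    refine .of_forall fun j => ?_
    have : zeros (pre (sorted 0) j) = j := by
      rw [zeros_pre, Nat.count_iff_forall]
      simp [sorted]
    simp [sortedCode, this]
  | succ c =>
    have hset : {i | sorted (c + 1) i = false} = Set.Iio c := by
      ext i
      simp [sorted]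
    have hc : {i | sorted (c + 1) i = false}.ncard = c := by
      rw [hset, ← Finset.coe_Iio, Set.ncard_coe_finset, Nat.card_Iio]
    filter_upwards [eventually_zeros_of_finite (hset ▸ Set.finite_Iio c),
      eventually_gt_atTop c] with j hj hcj
    rw [sortedCode, hj, hc, length_pre, if_pos hcj]

theorem sorted_injective : Function.Injective sorted := by
  intro h h' e
  obtain ⟨j, h1, h2⟩ := ((eventually_sortedCode h).and (eventually_sortedCode h')).exists
  rw [← h1, e, h2]

/-! ### The problem representing lim ⋆ Sort -/

/-- Sorting of the second component of a pair. -/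
noncomputable def sortOdds : MultiFun cantorSpace cantorSpace :=
  fun p => {(pair (evens p) (sortSeq (odds p)) : Cantor)}

theorem sortOdds_equivalent : Equivalent ⟨cantorSpace, cantorSpace, sortOdds⟩ sortProblem := by
  constructor
  · refine reducible_iff.2 ⟨_, _, (type2Computable_evens.comp type2Computable_evens).pair
      type2Computable_odds, type2Computable_odds, ?_⟩
    rintro p _ rfl -
    refine ⟨_, mem_total.2 rfl, odds p, rfl, ⟨_, rfl⟩, ?_⟩
    rintro _ _ rfl rfl
    refine ⟨_, Part.mem_bind (Part.mem_bind (mem_total.2 rfl) (mem_total.2 rfl))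
      (Part.mem_bind (mem_total.2 rfl) (Part.mem_some _)), _, rfl, ?_⟩
    change pair _ _ = pair _ _
    rw [evens_pair, odds_pair]
  · refine reducible_iff.2 ⟨_, _, type2Computable_odds.comp type2Computable_odds,
      type2Computable_id.pair type2Computable_id, ?_⟩
    rintro p _ rfl -
    refine ⟨_, Part.mem_bind (mem_total.2 rfl) (Part.mem_bind (mem_total.2 rfl) (Part.mem_some _)),
      _, rfl, ⟨_, rfl⟩, ?_⟩
    rintro _ _ rfl rfl
    refine ⟨_, Part.mem_bind (mem_total.2 rfl) (mem_total.2 rfl), _, rfl, ?_⟩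
    change odds (odds _) = sortSeq p
    simp

/-- On `⟨t, sorted h⟩`, the limit of the `h`-th double sequence coded in `t`. -/
def limSelect : MultiFun cantorSpace cantorSpace := fun p => {q : Cantor |
  ∃ h, odds p = sorted h ∧ ∀ n, ∀ᶠ j in atTop, evens p (Nat.pair h (Nat.pair n j)) = q n}

/-- On `⟨t, s⟩`, the limit of the double sequence coded in `t` that is selected by the number of
zeros of `s`. -/
noncomputable def limSort : Problem := ⟨cantorSpace, cantorSpace, limSelect.comp sortOdds⟩

theorem mem_limSort_fn {p q : Cantor} : q ∈ limSort.fn p ↔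
    ∀ n, ∀ᶠ j in atTop, evens p (Nat.pair (zeroCode (odds p)) (Nat.pair n j)) = q n := by
  have key : ∀ q : Cantor, q ∈ limSelect (pair (evens p) (sortSeq (odds p)) : Cantor) ↔
      ∀ n, ∀ᶠ j in atTop, evens p (Nat.pair (zeroCode (odds p)) (Nat.pair n j)) = q n := by
    intro q
    change (∃ h, odds (pair _ _) = sorted h ∧ ∀ n, ∀ᶠ j in atTop,
      evens (pair _ _) (Nat.pair h (Nat.pair n j)) = q n) ↔ _
    simp only [odds_pair, evens_pair, sortSeq_eq_sorted]
    exact ⟨fun ⟨h, e, H⟩ => sorted_injective e ▸ H, fun H => ⟨_, rfl, H⟩⟩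
  constructor
  · rintro ⟨-, _, rfl, hq⟩
    exact (key q).1 hq
  · intro hq
    refine ⟨?_, _, rfl, (key q).2 hq⟩
    rintro _ rfl
    exact ⟨q, (key q).2 hq⟩

/-- A stage up to which nested pairs can be looked up in a word of length `k`. -/
def depth (k : ℕ) : ℕ := Nat.sqrt (Nat.sqrt k - 1) - 1

theorem tendsto_depth : Tendsto depth atTop atTop :=
  tendsto_sqrt_sub_one.comp tendsto_sqrt_sub_one

theorem eventually_pair_depth_lt (h n : ℕ) :
    ∀ᶠ k in atTop, Nat.pair h (Nat.pair n (depth k)) < k := by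
  filter_upwards [eventually_pair_sqrt_lt h,
    tendsto_sqrt_sub_one.eventually (eventually_pair_sqrt_lt n)] with k h1 h2
  exact (Nat.pair_lt_pair_right h h2).trans h1

/-- The guess for the limit of the `h`-th double sequence, given a prefix of the code. -/
def selectWord (v : List Bool) (h : ℕ) : List Bool :=
  pre (fun n => bit v (Nat.pair h (Nat.pair n (depth v.length)))) v.length

@[fun_prop] theorem computable_selectWord {α : Type*} [Primcodable α] {f : α → List Bool}
    {g : α → ℕ} (hf : Computable f) (hg : Computable g) :
    Computable (fun a => selectWord (f a) (g a)) := by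
  unfold selectWord depth; fun_prop

theorem approx_selectWord {α : Type*} {l : Filter α} {t q : Cantor} {h : ℕ}
    (hq : ∀ n, ∀ᶠ j in atTop, t (Nat.pair h (Nat.pair n j)) = q n)
    {L : α → ℕ} (hL : Tendsto L l atTop) :
    Approx l (fun a => selectWord (pre t (L a)) h) q := by
  simp only [selectWord, length_pre]
  refine .of_bits hL fun n => ?_
  filter_upwards [hL.eventually (eventually_pair_depth_lt h n),
    (tendsto_depth.comp hL).eventually (hq n)] with a ha hb
  rw [bit_pre ha]
  exact hb

/-- The letters of a word at even positions. -/
def evensWord (w : List Bool) : List Bool := pre (evens (bit w)) (w.length / 2)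

/-- The letters of a word at odd positions. -/
def oddsWord (w : List Bool) : List Bool := pre (odds (bit w)) (w.length / 2)

@[fun_prop] theorem computable_evensWord {α : Type*} [Primcodable α] {f : α → List Bool}
    (hf : Computable f) : Computable (fun a => evensWord (f a)) := by
  unfold evensWord evens; fun_prop

@[fun_prop] theorem computable_oddsWord {α : Type*} [Primcodable α] {f : α → List Bool}
    (hf : Computable f) : Computable (fun a => oddsWord (f a)) := by
  unfold oddsWord odds; fun_prop

theorem evensWord_pre (p : Cantor) (k : ℕ) : evensWord (pre p k) = pre (evens p) (k / 2) := by
  refine (pre_prefix_pre_iff.2 ⟨by simp, fun i hi => ?_⟩ : _ <+: _).eq_of_length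
    (by simp)
  rw [length_pre] at hi
  exact bit_pre (by omega)

theorem oddsWord_pre (p : Cantor) (k : ℕ) : oddsWord (pre p k) = pre (odds p) (k / 2) := by
  refine (pre_prefix_pre_iff.2 ⟨by simp, fun i hi => ?_⟩ : _ <+: _).eq_of_length
    (by simp)
  rw [length_pre] at hi
  exact bit_pre (by omega)

theorem tendsto_div_two : Tendsto (fun k : ℕ => k / 2) atTop atTop :=
  Nat.tendsto_div_const_atTop (by norm_num)

theorem limSelect_limComputable : LimComputable ⟨cantorSpace, cantorSpace, limSelect⟩ := by
  refine ⟨fun w => selectWord (evensWord w) (sortedCode (oddsWord w)), by fun_prop, ?_⟩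
  rintro p _ rfl ⟨q, h, ho, hq⟩
  refine ⟨q, ⟨q, ⟨h, ho, hq⟩, rfl⟩, (approx_selectWord hq tendsto_div_two).congr ?_⟩
  filter_upwards [tendsto_div_two.eventually (eventually_sortedCode h)] with j hj
  rw [evensWord_pre, oddsWord_pre, ho, hj]

theorem Reducible.of_fn_eq {f g : MultiFun cantorSpace cantorSpace} {H : Cantor → Cantor}
    (hH : Type2Computable (total H)) (h : ∀ p, g (H p) = f p) :
    Reducible ⟨cantorSpace, cantorSpace, f⟩ ⟨cantorSpace, cantorSpace, g⟩ := by
  refine .of_total type2Computable_odds hH ?_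
  rintro p _ rfl hp
  refine ⟨H p, rfl, show (g (H p)).Nonempty from (h p).symm ▸ hp, ?_⟩
  rintro s _ hz rfl
  exact ⟨s, show s ∈ f p from h p ▸ hz, odds_pair _ _⟩

/-- The constant selection: all double sequences coded are equal to `t`. -/
def constSelect (t : Cantor) : Cantor := pair (fun m => t m.unpair.2) (sorted 0)

theorem type2Computable_constSelect : Type2Computable (total constSelect) :=
  type2Computable_total (fun w m => if m % 2 = 0 then bit w (m / 2).unpair.2 else
    sorted 0 (m / 2)) (by fun_prop) fun p m => by
      rw [bit_pre (by have := Nat.unpair_right_le (m / 2); omega)]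
      rfl

theorem limSelect_constSelect (t : Cantor) : limSelect (constSelect t) = limFn t := by
  ext q
  change (∃ h, odds (pair _ _) = sorted h ∧ ∀ n, ∀ᶠ j in atTop,
      evens (pair _ _) (Nat.pair h (Nat.pair n j)) = (q : Cantor) n) ↔ LimRel t q
  simp only [odds_pair, evens_pair, Nat.unpair_pair]
  exact ⟨fun ⟨_, _, H⟩ => H, fun H => ⟨0, rfl, H⟩⟩

theorem limSort_constSelect (t : Cantor) :
    (limSelect.comp sortOdds) (constSelect t) = limFn t := by
  ext q
  refine mem_limSort_fn.trans ?_
  simp only [constSelect, evens_pair, Nat.unpair_pair]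
  rfl

theorem limSelect_equivalent : Equivalent ⟨cantorSpace, cantorSpace, limSelect⟩ limProblem := by
  refine ⟨limSelect_limComputable.reducible.trans limCantor_equivalent_limProblem.1,
    limCantor_equivalent_limProblem.2.trans
      (.of_fn_eq type2Computable_constSelect limSelect_constSelect)⟩

/-! ### Upper bounds for compositions -/

theorem MultiFun.comp_nonempty {X Y Z : RepSpace} {f : MultiFun Y Z} {g : MultiFun X Y}
    {x : X.carrier} (h : (f.comp g x).Nonempty) :
    (g x).Nonempty ∧ ∀ y ∈ g x, (f y).Nonempty ∧ ∀ z ∈ f y, z ∈ f.comp g x := by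
  obtain ⟨z, H, y, hy, -⟩ := h
  exact ⟨⟨y, hy⟩, fun y hy => ⟨H y hy, fun z hz => ⟨H, y, hy, hz⟩⟩⟩

/-- Truncating at i turns the approximations of y into an exact prefix of y for late j, as `C`
requires, since it need not be monotone. -/
theorem Approx.iter_take {C : List Bool → List Bool} {v : ℕ → List Bool} {y z : Cantor}
    (hz : Approx atTop (fun i => C (pre y i)) z) (hv : Approx atTop v y) :
    Approx iter (fun x => C ((v x.2).take x.1)) z := by
  intro n
  refine eventually_iter.2 ?_
  filter_upwards [hz n] with i hi
  filter_upwards [hv.take_eq i] with j hj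
  rwa [hj]

section Composition

variable {X Y Z : RepSpace} {f : MultiFun Y Z} {g : MultiFun X Y}

theorem LimComputable.comp_limComputable (hf : LimComputable ⟨Y, Z, f⟩)
    (hg : LimComputable ⟨X, Y, g⟩) : LimLimComputable ⟨X, Z, f.comp g⟩ := by
  obtain ⟨C, hC, hf⟩ := hf
  obtain ⟨D, hD, hg⟩ := hg
  refine ⟨fun x => C ((D x.1).take x.2), by fun_prop, fun p x hp hx => ?_⟩
  obtain ⟨hgx, H⟩ := MultiFun.comp_nonempty hx
  obtain ⟨q, ⟨y, hy, hqy⟩, hq⟩ := hg p x hp hgx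
  obtain ⟨hfy, H⟩ := H y hy
  obtain ⟨r, ⟨z, hz, hrz⟩, hr⟩ := hf q y hqy hfy
  exact ⟨r, ⟨z, H z hz, hrz⟩, hr.iter_take hq⟩

theorem LimComputable.comp_reducible_limSort (hf : LimComputable ⟨Y, Z, f⟩)
    (hg : Reducible ⟨X, Y, g⟩ limSort) : LimLimComputable ⟨X, Z, f.comp g⟩ := by
  obtain ⟨C, hC, hf⟩ := hf
  obtain ⟨K, H, hK, hH, hg⟩ := reducible_iff.1 hg
  obtain ⟨M, hM, HM⟩ := type2Computable_iff.1 hK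
  obtain ⟨N, hN, HN⟩ := type2Computable_iff.1 hH
  have hMc := hM.1
  have hNc := hN.1
  let D : List Bool → ℕ → List Bool := fun w h => M (inter w (selectWord (evensWord (N w)) h))
  refine ⟨fun x => C ((D x.1 (zeroGuess (oddsWord (N x.1)) x.2)).take x.2), by fun_prop,
    fun p x hp hx => ?_⟩
  obtain ⟨hgx, Hf⟩ := MultiFun.comp_nonempty hx
  obtain ⟨t, hr, _, rfl, ⟨s, hs⟩, Hg⟩ := hg p x hp hgx
  obtain ⟨q, hq, y, hy, hqy⟩ := Hg s s hs rfl
  obtain ⟨hfy, Hf⟩ := Hf y hy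
  obtain ⟨r, ⟨z, hz, hrz⟩, hr'⟩ := hf q y hqy hfy
  obtain ⟨L, hL, hNL⟩ := (HN _ _ hr).exists_length hN
  have hL2 := tendsto_div_two.comp hL
  have hD : Approx atTop (fun j => D (pre p j) (zeroCode (odds t))) q := by
    refine Approx.machine (.inter (.of_pre p tendsto_id) ?_) hM (HM _ _ hq)
    simp only [hNL, evensWord_pre]
    exact approx_selectWord (mem_limSort_fn.1 hs) hL2
  -- The index i is both the threshold of the zero guess and the truncation length, and j drives
  -- both inner limits. For late i, then late j, the guess is the true code.
  refine ⟨r, ⟨z, Hf z hz, hrz⟩, (hr'.iter_take hD).congr (eventually_iter.2 ?_)⟩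
  filter_upwards [eventually_zeroGuess (odds t) hL2] with i hi
  filter_upwards [hi] with j hj
  simp only [hNL, oddsWord_pre]
  rw [← hj]
  rfl

theorem LimLimComputable.comp_reducible_sort (hf : LimLimComputable ⟨Y, Z, f⟩)
    (hg : Reducible ⟨X, Y, g⟩ sortProblem) : LimLimComputable ⟨X, Z, f.comp g⟩ := by
  obtain ⟨C, hC, hf⟩ := hf
  obtain ⟨K, H, hK, hH, hg⟩ := reducible_iff.1 hg
  obtain ⟨M, hM, HM⟩ := type2Computable_iff.1 hK
  obtain ⟨N, hN, HN⟩ := type2Computable_iff.1 hH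
  have hMc := hM.1
  have hNc := hN.1
  refine ⟨fun x => C (M (inter x.1 (pre (sorted (zeroGuess (N x.1) x.2)) x.1.length)), x.2),
    by fun_prop, fun p x hp hx => ?_⟩
  obtain ⟨hgx, Hf⟩ := MultiFun.comp_nonempty hx
  obtain ⟨s, hr, _, rfl, -, Hg⟩ := hg p x hp hgx
  obtain ⟨q, hq, y, hy, hqy⟩ := Hg _ _ rfl rfl
  obtain ⟨hfy, Hf⟩ := Hf y hy
  obtain ⟨r, ⟨z, hz, hrz⟩, hr'⟩ := hf q y hqy hfy
  obtain ⟨L, hL, hNL⟩ := (HN _ _ hr).exists_length hN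
  obtain ⟨L', hL', hML⟩ := (HM _ _ hq).exists_length hM
  have ht : Tendsto (fun j => L' (2 * j)) atTop atTop :=
    hL'.comp (tendsto_id.const_mul_atTop' (by norm_num))
  -- Once the code is guessed correctly, `M` receives a genuine prefix, of length 2j, of the pair,
  -- and so outputs a genuine prefix of q. This merely reparametrises the inner limit of `C`.
  have hit : Tendsto (fun x : ℕ × ℕ => (x.1, L' (2 * x.2))) iter iter := fun S hS =>
    eventually_iter.2 ((eventually_iter.1 hS).mono fun _ hi => ht.eventually hi)
  refine ⟨r, ⟨z, Hf z hz, hrz⟩, (hr'.comp hit).congr (eventually_iter.2 ?_)⟩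
  filter_upwards [eventually_zeroGuess s hL] with i hi
  filter_upwards [hi] with j hj
  simp only [hNL, length_pre, hj, ← sortSeq_eq_sorted, inter_pre, min_self]
  rw [hML]

theorem LimComputable.comp_reducible_sort (hf : LimComputable ⟨Y, Z, f⟩)
    (hg : Reducible ⟨X, Y, g⟩ sortProblem) : Reducible ⟨X, Z, f.comp g⟩ limSort := by
  obtain ⟨C, hC, hf⟩ := hf
  obtain ⟨K, H, hK, hH, hg⟩ := reducible_iff.1 hg
  obtain ⟨M, hM, HM⟩ := type2Computable_iff.1 hK
  have hMc := hM.1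
  -- For each candidate code h, the run of `C` after `M` under the assumption that Sort returned
  -- `sorted h`. Only the sequence for the true code has to converge.
  let T : Cantor → Cantor := fun p m => bit (C (M (inter (pre p m.unpair.2.unpair.2)
    (pre (sorted m.unpair.1) m.unpair.2.unpair.2)))) m.unpair.2.unpair.1
  have hT : Type2Computable (total T) :=
    type2Computable_total (fun w m => bit (C (M (inter (w.take m.unpair.2.unpair.2)
      (pre (sorted m.unpair.1) m.unpair.2.unpair.2)))) m.unpair.2.unpair.1) (by fun_prop)
      fun p m => by
        have h1 := Nat.unpair_right_le m
        have h2 := Nat.unpair_right_le m.unpair.2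
        rw [take_pre (by omega)]
  refine reducible_iff.2 ⟨_, _, type2Computable_odds, hT.pair hH, fun p x hp hx => ?_⟩
  obtain ⟨hgx, Hf⟩ := MultiFun.comp_nonempty hx
  obtain ⟨s, hr, _, rfl, -, Hg⟩ := hg p x hp hgx
  obtain ⟨q, hq, y, hy, hqy⟩ := Hg _ _ rfl rfl
  obtain ⟨hfy, Hf⟩ := Hf y hy
  obtain ⟨r, ⟨z, hz, hrz⟩, hr'⟩ := hf q y hqy hfy
  obtain ⟨L, hL, hML⟩ := (HM _ _ hq).exists_length hM
  have ht : Tendsto (fun j => L (2 * j)) atTop atTop :=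
    hL.comp (tendsto_id.const_mul_atTop' (by norm_num))
  have hlim : LimRel (fun m => T p (Nat.pair (zeroCode s) m)) r := fun n => by
    filter_upwards [(hr'.comp ht).eventually_bit n] with j hj
    simp only [T, Nat.unpair_pair, ← sortSeq_eq_sorted, inter_pre, min_self]
    rw [hML]
    exact hj
  refine ⟨_, Part.mem_bind (mem_total.2 rfl) (Part.mem_bind hr (Part.mem_some _)), _, rfl,
    ⟨r, mem_limSort_fn.2 ?_⟩, ?_⟩
  · simp only [evens_pair, odds_pair]
    exact hlim
  · rintro u _ hu rfl
    have hu' := mem_limSort_fn.1 hu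
    simp only [evens_pair, odds_pair] at hu'
    cases LimRel.unique hlim hu'
    exact ⟨_, mem_total.2 rfl, z, Hf z hz, (odds_pair _ _).symm ▸ hrz⟩

end Composition

/-! ### The four compositional products -/

theorem isStar_lim_lim : IsStar limProblem limProblem limLimCantor := by
  refine ⟨⟨_, _, _, limFn, limFn, limCantor_equivalent_limProblem,
    limCantor_equivalent_limProblem, .refl _⟩, fun X Y Z f g hf hg => ?_⟩
  exact ((hf.1.trans limCantor_equivalent_limProblem.2).limComputable.comp_limComputable
    (hg.1.trans limCantor_equivalent_limProblem.2).limComputable).reducible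

theorem isStar_lim_sort : IsStar limProblem sortProblem limSort :=
  ⟨⟨_, _, _, limSelect, sortOdds, limSelect_equivalent, sortOdds_equivalent, .refl _⟩,
    fun _ _ _ _ _ hf hg => (hf.1.trans
      limCantor_equivalent_limProblem.2).limComputable.comp_reducible_sort hg.1⟩

theorem isStar_limLim_sort : IsStar limLimCantor sortProblem limLimCantor := by
  -- The maximum is attained by a version of lim ∘ lim that ignores the odd half, the only part
  -- `sortOdds` changes.
  let F : MultiFun cantorSpace cantorSpace := fun p => limFn.comp limFn (evens p)
  have hF : Equivalent ⟨cantorSpace, cantorSpace, F⟩ limLimCantor := by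
    refine ⟨.of_fn_eq type2Computable_evens fun _ => rfl, .of_fn_eq (H := fun p => pair p p)
      (type2Computable_total (fun w m => bit w (m / 2)) (by fun_prop) fun p m => ?_) fun p =>
        congrArg (limFn.comp limFn) (evens_pair p p)⟩
    rw [bit_pre (by omega), pair, ite_self]
  have hcomp : F.comp sortOdds = F := by
    funext p
    have e : F (pair (evens p) (sortSeq (odds p)) : Cantor) = F p :=
      congrArg (limFn.comp limFn) (evens_pair _ _)
    ext z
    constructor
    · rintro ⟨-, _, rfl, hz⟩
      exact e ▸ hz
    · intro hz
      rw [← e] at hz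
      refine ⟨?_, _, rfl, hz⟩
      rintro _ rfl
      exact ⟨z, hz⟩
  refine ⟨⟨_, _, _, F, sortOdds, hF, sortOdds_equivalent, hcomp.symm ▸ hF⟩,
    fun X Y Z f g hf hg => ?_⟩
  exact (hf.1.limLimComputable.comp_reducible_sort hg.1).reducible

theorem isStar_lim_limSort : IsStar limProblem limSort limLimCantor := by
  have upper : ∀ {X Y Z : RepSpace} {f : MultiFun Y Z} {g : MultiFun X Y},
      Reducible ⟨Y, Z, f⟩ limProblem → Reducible ⟨X, Y, g⟩ limSort →
      Reducible ⟨X, Z, f.comp g⟩ limLimCantor := fun hf hg =>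
    ((hf.trans limCantor_equivalent_limProblem.2).limComputable.comp_reducible_limSort
      hg).reducible
  refine ⟨⟨_, _, _, limFn, limSelect.comp sortOdds, limCantor_equivalent_limProblem, .refl _,
    upper limCantor_equivalent_limProblem.1 (.refl _), ?_⟩,
    fun X Y Z f g hf hg => upper hf.1 hg.1⟩
  -- Lower bound: with all selectable sequences equal, `limSort` acts as lim, so lim after it is lim
  -- ∘ lim.
  refine .of_fn_eq type2Computable_constSelect fun p => ?_
  unfold MultiFun.comp
  rw [← limSort_constSelect p]
  rfl

end Weihrauch

theorem mainTheorem11 :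
    ∃ limLim limSort limLim_Sort lim_LimSort : Weihrauch.Problem,
      Weihrauch.IsStar Weihrauch.limProblem Weihrauch.limProblem limLim ∧
      Weihrauch.IsStar Weihrauch.limProblem Weihrauch.sortProblem limSort ∧
      Weihrauch.IsStar limLim Weihrauch.sortProblem limLim_Sort ∧
      Weihrauch.IsStar Weihrauch.limProblem limSort lim_LimSort ∧
      Weihrauch.Equivalent limLim_Sort limLim ∧
      Weihrauch.Equivalent lim_LimSort limLim :=
  ⟨Weihrauch.limLimCantor, Weihrauch.limSort, Weihrauch.limLimCantor, Weihrauch.limLimCantor,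
    Weihrauch.isStar_lim_lim, Weihrauch.isStar_lim_sort, Weihrauch.isStar_limLim_sort,
    Weihrauch.isStar_lim_limSort, .refl _, .refl _⟩
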